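/- Let $n\ge 3$, $\alpha=\frac{n-2}{2}$, and let $\mu$ be the (unnormalized) volume measure on the unit sphere $S^{n-1}\subset\mathbb R^n$. Let the Gegenbauer polynomials be given by $C^{(\alpha)}_0(t)=1$, $C^{(\alpha)}_1(t)=2\alpha t$ and $C^{(\alpha)}_j(t)=\frac1j\left[2t(j+\alpha-1)C^{(\alpha)}_{j-1}(t)-(j+2\alpha-2)C^{(\alpha)}_{j-2}(t)\right]$ for $j\ge 2$. For a univariate real polynomial $u$ and $f:S^{n-1}\to\mathbb R$ put $T_u(f)(x)=\int_{S^{n-1}}u(\langle x,y\rangle)f(y)\,d\mu(y)$. **Theorem.** For every integer $k\ge 0$ the polynomial $C^{(\alpha)}_{k+1}$ has a largest real root $\lambda_{k+1}$, and $\lambda_{k+1}<1$. With $d=2k$, there is a constant $c>0$ such that the polynomial $$u(t)=c\left(\frac{C^{(\alpha)}_{k+1}(t)}{t-\lambda_{k+1}}\right)^2$$ satisfies $\int_{S^{n-1}}u(\langle x,y\rangle)\,d\mu(y)=1$ for all $x\in S^{n-1}$, has degree $d$, is nonnegative on $[-1,1]$, and for every $f:S^{n-1}\to\mathbb R$ with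 Lipschitz constant $\kappa$ with respect to the geodesic distance, i.e. $|f(x)-f(y)|\le\kappa\arccos\langle x,y\rangle$ for all $x,y\in S^{n-1}$, $$\|f-T_u(f)\|_\infty=\sup_{x\in S^{n-1}}|f(x)-T_u(f)(x)|\le\left(\frac{\pi}{\sqrt2}\sqrt{1-\lambda_{k+1}}\right)\kappa .$$ Furthermore, for fixed $n$ and $\kappa$, as $d=2k\to\infty$ the right-hand side is of the same order as $\frac{\pi(n-2)}{\sqrt2}\,\frac{\kappa}{d}$: each of the two quantities is bounded by a constant multiple of the other for all sufficiently large $k$. -/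

import Mathlib

open MeasureTheory Polynomial Asymptotics Filter

noncomputable section

/-- The Gegenbauer (ultraspherical) polynomials of parameter `α`, by their three-term recursion
(the last clause is the recursion for the index `j + 2`). -/
def gegenbauer (α : ℝ) : ℕ → ℝ[X]
  | 0 => 1
  | 1 => C (2 * α) * X
  | j + 2 => C (1 / ((j : ℝ) + 2)) *
      (2 * X * C (((j : ℝ) + 2) + α - 1) * gegenbauer α (j + 1)
        - C (((j : ℝ) + 2) + 2 * α - 2) * gegenbauer α j)

/-- The largest real root of the `j`-th Gegenbauer polynomial of parameter `α`. -/
def gegenbauerLargestRoot (α : ℝ) (j : ℕ) : ℝ :=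
  sSup {t : ℝ | (gegenbauer α j).IsRoot t}

/-- The unit sphere `S^{n-1}` of `ℝ^n`. -/
abbrev UnitSphere (n : ℕ) : Type := Metric.sphere (0 : EuclideanSpace ℝ (Fin n)) 1

/-- The (unnormalized) volume measure of `S^{n-1}`. -/
abbrev sphereMeasure (n : ℕ) : Measure (UnitSphere n) :=
  (volume : Measure (EuclideanSpace ℝ (Fin n))).toSphere

/-- The geodesic distance on `S^{n-1}`. -/
def geodesicDist {n : ℕ} (x y : UnitSphere n) : ℝ :=
  Real.arccos (inner ℝ (x : EuclideanSpace ℝ (Fin n)) (y : EuclideanSpace ℝ (Fin n)))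

/-- `κ` is a Lipschitz constant of `f` for the geodesic distance on `S^{n-1}`. -/
def HasLipschitzConstant {n : ℕ} (f : UnitSphere n → ℝ) (κ : ℝ) : Prop :=
  ∀ x y : UnitSphere n, |f x - f y| ≤ κ * geodesicDist x y

/-- The spherical convolution `T_u f` of `f` with the polynomial filter `u`. -/
def sphericalConvolution {n : ℕ} (u : ℝ[X]) (f : UnitSphere n → ℝ) (x : UnitSphere n) : ℝ :=
  ∫ y : UnitSphere n,
    u.eval (inner ℝ (x : EuclideanSpace ℝ (Fin n)) (y : EuclideanSpace ℝ (Fin n))) * f y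
      ∂(sphereMeasure n)

end

/-! Write `C_{k+1} = (X - λ) q` and `u = c q²`. Since `(X - λ) u = c q C_{k+1}` and `deg q ≤ k`,
orthogonality of `C_{k+1}` to lower degrees makes the first moment of `u` equal to `λ`. As `u` has
mass one, `|f - T_u f|` is at most `κ` times the `u`-average of `arccos t ≤ (π/√2) √(1 - t)`, and
concavity of the root turns this into `(π/√2) √(1 - λ) κ`.

Orthogonality is derived from a single identity for a functional, `L((1 - X²) q') = (2α + 1) L(X
q)`. For `p ↦ ∫ p(⟨x,y⟩) dμ(y)` it amounts to a moment recursion, obtained from Gaussian integrals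
in polar coordinates. Orthogonality and positivity of `L` also give that all roots are real and less
than 1.

For the order of `1 - λ`, the sums of `1/(1 - r)` and `1/(1 - r)²` over the roots are read off from
the first two derivatives at 1, which the differential equation supplies; they give `1 - λ ≍ 1/k²`.
-/

/-! ### Algebra of the Gegenbauer polynomials -/

theorem gegenbauer_recurrence (α : ℝ) (j : ℕ) :
    C ((j : ℝ) + 2) * gegenbauer α (j + 2) =
      C (2 * ((j : ℝ) + 1 + α)) * X * gegenbauer α (j + 1)
        - C ((j : ℝ) + 2 * α) * gegenbauer α j := by
  have h : (j : ℝ) + 2 ≠ 0 := by positivity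
  rw [gegenbauer, ← mul_assoc, ← C_mul, mul_one_div_cancel h, C_1, one_mul]
  simp only [C_add, C_mul, C_sub, C_1, map_ofNat]
  ring

/-- The two relations are proved together because the inductive step for each needs both. The second
feeds the integration-by-parts identity; together they yield the differential equation. -/
theorem gegenbauer_derivative_relations (α : ℝ) (m : ℕ) :
    derivative (gegenbauer α (m + 1)) =
        X * derivative (gegenbauer α m) + C ((m : ℝ) + 2 * α) * gegenbauer α m ∧
      (1 - X ^ 2) * derivative (gegenbauer α m) =
        C ((m : ℝ) + 2 * α) * X * gegenbauer α m - C ((m : ℝ) + 1) * gegenbauer α (m + 1) := by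
  induction m with
  | zero => constructor <;> simp [gegenbauer]
  | succ m ih =>
    obtain ⟨h₁, h₂⟩ := ih
    have hr := gegenbauer_recurrence α m
    have hc : (C ((m : ℝ) + 2) : ℝ[X]) ≠ 0 := by
      rw [Ne, C_eq_zero]; positivity
    have hd := congrArg derivative hr
    simp only [derivative_mul, derivative_C, derivative_X, derivative_sub, zero_mul, zero_add,
      mul_one] at hd
    simp only [C_add, C_mul, C_1, map_ofNat, Nat.cast_add, Nat.cast_one] at *
    constructor
    · apply mul_left_cancel₀ hc
      linear_combination hd - (C (m : ℝ) + 2 * C α) * (h₂ - X * h₁)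
    · linear_combination (1 - X ^ 2) * h₁ + X * h₂ + hr

theorem gegenbauer_eval_one (α : ℝ) (m : ℕ) :
    ((m : ℝ) + 1) * (gegenbauer α (m + 1)).eval 1 = (m + 2 * α) * (gegenbauer α m).eval 1 := by
  have h := congrArg (eval 1) (gegenbauer_derivative_relations α m).2
  simp at h
  linarith

theorem gegenbauer_eval_one_pos {α : ℝ} (hα : 0 < α) (m : ℕ) :
    0 < (gegenbauer α m).eval 1 := by
  induction m with
  | zero => simp [gegenbauer]
  | succ m ih =>
    have h := gegenbauer_eval_one α m
    have : 0 < (m + 2 * α) * (gegenbauer α m).eval 1 := by positivity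
    rw [← h] at this
    exact pos_of_mul_pos_right this (by positivity)

/-- The differential equation of the Gegenbauer polynomials. -/
theorem gegenbauer_differential_equation (α : ℝ) (m : ℕ) :
    (1 - X ^ 2) * derivative (derivative (gegenbauer α m)) -
      C (2 * α + 1) * X * derivative (gegenbauer α m) +
      C ((m : ℝ) * (m + 2 * α)) * gegenbauer α m = 0 := by
  obtain ⟨h₁, h₂⟩ := gegenbauer_derivative_relations α m
  have hd := congrArg derivative h₂
  simp only [derivative_mul, derivative_C, derivative_X, derivative_sub, zero_mul, zero_add,
    mul_one, derivative_one, derivative_X_pow, zero_sub] at hd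
  simp only [C_add, C_mul, C_1, map_ofNat, Nat.cast_ofNat] at *
  linear_combination hd - (C (m : ℝ) + 1) * h₁

theorem gegenbauer_derivative_eval_one (α : ℝ) (m : ℕ) :
    (2 * α + 1) * (derivative (gegenbauer α m)).eval 1 =
      m * (m + 2 * α) * (gegenbauer α m).eval 1 := by
  have h := congrArg (eval 1) (gegenbauer_differential_equation α m)
  simp at h
  linarith

theorem gegenbauer_derivative_derivative_eval_one (α : ℝ) (m : ℕ) :
    (2 * α + 3) * (derivative (derivative (gegenbauer α m))).eval 1 =
      (m * (m + 2 * α) - (2 * α + 1)) * (derivative (gegenbauer α m)).eval 1 := by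
  have h := congrArg (fun p => eval 1 (derivative p)) (gegenbauer_differential_equation α m)
  simp [derivative_mul] at h
  linarith

theorem gegenbauer_natDegree_le (α : ℝ) (m : ℕ) :
    (gegenbauer α m).natDegree ≤ m ∧ (gegenbauer α (m + 1)).natDegree ≤ m + 1 := by
  induction m with
  | zero => exact ⟨by simp [gegenbauer], by simpa [gegenbauer] using natDegree_C_mul_le (2 * α) X⟩
  | succ m ih =>
    refine ⟨ih.2, ?_⟩
    have hc : ((m : ℝ) + 2) ≠ 0 := by positivity
    rw [← natDegree_C_mul hc, gegenbauer_recurrence]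
    refine (natDegree_sub_le _ _).trans (max_le ?_ ?_)
    · rw [mul_assoc]
      refine (natDegree_C_mul_le _ _).trans (natDegree_mul_le.trans ?_)
      rw [natDegree_X]; omega
    · exact (natDegree_C_mul_le _ _).trans (by omega)

theorem gegenbauer_coeff_pos {α : ℝ} (hα : 0 < α) (m : ℕ) :
    0 < (gegenbauer α m).coeff m := by
  induction m with
  | zero => simp [gegenbauer]
  | succ m ih =>
    cases m with
    | zero => simpa [gegenbauer] using hα
    | succ m =>
      have h := congrArg (fun p => coeff p (m + 2)) (gegenbauer_recurrence α m)
      have h0 : (gegenbauer α m).coeff (m + 2) = 0 :=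
        coeff_eq_zero_of_natDegree_lt (by have := (gegenbauer_natDegree_le α m).1; omega)
      simp only [coeff_sub, mul_assoc, coeff_C_mul, coeff_X_mul, h0, mul_zero, sub_zero] at h
      have : 0 < ((m : ℝ) + 2) * (gegenbauer α (m + 2)).coeff (m + 2) := by
        rw [h]; positivity
      exact pos_of_mul_pos_right this (by positivity)

theorem gegenbauer_natDegree {α : ℝ} (hα : 0 < α) (m : ℕ) : (gegenbauer α m).natDegree = m :=
  le_antisymm (gegenbauer_natDegree_le α m).1
    (le_natDegree_of_ne_zero (gegenbauer_coeff_pos hα m).ne')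

theorem gegenbauer_ne_zero {α : ℝ} (hα : 0 < α) (m : ℕ) : gegenbauer α m ≠ 0 := by
  intro h
  simpa [h] using gegenbauer_coeff_pos hα m

/-! ### Orthogonality and location of the roots, for an abstract functional -/

section Functional

variable {α : ℝ} {L : ℝ[X] →ₗ[ℝ] ℝ}

theorem functional_C_mul (L : ℝ[X] →ₗ[ℝ] ℝ) (a : ℝ) (p : ℝ[X]) : L (C a * p) = a * L p := by
  rw [← smul_eq_C_mul, map_smul, smul_eq_mul]

/-- Applying `hL` to `C_m` relates `L(X C_m)` to `L(C_{m+1})`. The recurrence gives a second,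
independent relation once `L(C_{m-1}) = 0`, so both values vanish. -/
theorem functional_gegenbauer_eq_zero (hα : 0 < α)
    (hL : ∀ q, L ((1 - X ^ 2) * derivative q) = (2 * α + 1) * L (X * q)) (m : ℕ) :
    L (gegenbauer α (m + 1)) = 0 := by
  have key (m : ℕ) : ((m : ℝ) - 1) * L (X * gegenbauer α m) =
      (m + 1) * L (gegenbauer α (m + 1)) := by
    have h := hL (gegenbauer α m)
    rw [(gegenbauer_derivative_relations α m).2, map_sub, mul_assoc, functional_C_mul,
      functional_C_mul] at h
    linarith
  induction m using Nat.twoStepInduction with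
  | zero =>
    have h := hL 1
    simp only [derivative_one, mul_zero, map_zero, mul_one] at h
    have h' : L X = 0 := (mul_eq_zero.1 h.symm).resolve_left (by positivity)
    simp only [gegenbauer]
    rw [functional_C_mul, h', mul_zero]
  | one => simpa using key 1
  | more m ih _ =>
    have h₁ := key (m + 2)
    have h₂ := congrArg L (gegenbauer_recurrence α (m + 1))
    rw [map_sub, mul_assoc, functional_C_mul, functional_C_mul, functional_C_mul, ih, mul_zero,
      sub_zero] at h₂
    push_cast at h₁ h₂
    have h : L (X * gegenbauer α (m + 2)) = 0 := by
      have : ((m : ℝ) + 2 * α + 3) * L (X * gegenbauer α (m + 2)) = 0 := by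
        linear_combination -h₁ - h₂
      exact (mul_eq_zero.1 this).resolve_left (by positivity)
    rw [h, mul_zero] at h₁
    exact (mul_eq_zero.1 h₁.symm).resolve_left (by positivity)

/-- The recurrence trades one factor `X` for a shift of the index by one either way, and `j < m`
survives the trade. -/
theorem functional_X_pow_mul_gegenbauer_eq_zero (hα : 0 < α)
    (hL : ∀ q, L ((1 - X ^ 2) * derivative q) = (2 * α + 1) * L (X * q)) (j m : ℕ) (h : j < m) :
    L (X ^ j * gegenbauer α m) = 0 := by
  induction j generalizing m with
  | zero =>
    obtain ⟨m, rfl⟩ := Nat.exists_eq_add_of_lt h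
    simpa using functional_gegenbauer_eq_zero hα hL _
  | succ j ih =>
    obtain ⟨m, rfl⟩ : ∃ i, m = i + 1 := ⟨m - 1, by omega⟩
    have hr := congrArg (fun p => L (X ^ j * p)) (gegenbauer_recurrence α m)
    have e (a : ℝ) (p : ℝ[X]) : L (X ^ j * (C a * p)) = a * L (X ^ j * p) := by
      rw [← functional_C_mul]; congr 1; ring
    simp only [mul_sub, map_sub, mul_assoc, e] at hr
    rw [ih _ (by omega), ih m (by omega), ← mul_assoc (X ^ j), ← pow_succ] at hr
    have : (2 * (((m : ℝ) + 1 + α))) * L (X ^ (j + 1) * gegenbauer α (m + 1)) = 0 := by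
      linarith
    exact (mul_eq_zero.1 this).resolve_left (by positivity)

theorem functional_mul_gegenbauer_eq_zero (hα : 0 < α)
    (hL : ∀ q, L ((1 - X ^ 2) * derivative q) = (2 * α + 1) * L (X * q)) {m : ℕ} {q : ℝ[X]}
    (hq : q.natDegree < m) : L (q * gegenbauer α m) = 0 := by
  rw [q.as_sum_range_C_mul_X_pow, Finset.sum_mul, map_sum]
  refine Finset.sum_eq_zero fun j hj => ?_
  rw [mul_assoc, functional_C_mul,
    functional_X_pow_mul_gegenbauer_eq_zero hα hL _ _ (by rw [Finset.mem_range] at hj; omega),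
    mul_zero]

/-- A factor of a Gegenbauer polynomial of positive degree changes sign on `[-1, 1]`. -/
theorem gegenbauer_factor_exists_neg (hα : 0 < α)
    (hL : ∀ q, L ((1 - X ^ 2) * derivative q) = (2 * α + 1) * L (X * q))
    (hpos : ∀ p : ℝ[X], p ≠ 0 → (∀ t ∈ Set.Icc (-1 : ℝ) 1, 0 ≤ p.eval t) → 0 < L p)
    {m : ℕ} {p : ℝ[X]} (hdvd : p ∣ gegenbauer α m) (hp : 0 < p.natDegree) :
    ∃ t ∈ Set.Icc (-1 : ℝ) 1, p.eval t < 0 := by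
  by_contra! hneg
  obtain ⟨q, hq⟩ := hdvd
  have hne := gegenbauer_ne_zero hα m
  have hq0 : q ≠ 0 := by rintro rfl; simp [hq] at hne
  have hp0 : p ≠ 0 := by rintro rfl; simp at hp
  have hdeg := gegenbauer_natDegree hα m
  rw [hq, natDegree_mul hp0 hq0] at hdeg
  have h0 := functional_mul_gegenbauer_eq_zero hα hL (m := m) (q := q) (by omega)
  -- With `C_m = p q`, positivity of `q² p = q C_m` contradicts orthogonality, as `deg q < m`.
  have h1 := hpos (q ^ 2 * p) (by positivity) fun t ht => by
    rw [eval_mul, eval_pow]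
    exact mul_nonneg (sq_nonneg _) (hneg t ht)
  rw [hq, show q * (p * q) = q ^ 2 * p by ring] at h0
  linarith

theorem gegenbauer_root_lt_one (hα : 0 < α)
    (hL : ∀ q, L ((1 - X ^ 2) * derivative q) = (2 * α + 1) * L (X * q))
    (hpos : ∀ p : ℝ[X], p ≠ 0 → (∀ t ∈ Set.Icc (-1 : ℝ) 1, 0 ≤ p.eval t) → 0 < L p)
    {m : ℕ} {r : ℝ} (hr : (gegenbauer α m).IsRoot r) : r < 1 := by
  obtain ⟨t, ht, h⟩ := gegenbauer_factor_exists_neg hα hL hpos (p := -(X - C r))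
    ((neg_dvd).2 (dvd_iff_isRoot.2 hr)) (by rw [natDegree_neg, natDegree_X_sub_C]; exact one_pos)
  simp at h
  linarith [ht.2]

/-- An irreducible factor `g` and its negative both take negative values on `[-1, 1]`, so `g` has a
real root and is linear. -/
theorem gegenbauer_splits (hα : 0 < α)
    (hL : ∀ q, L ((1 - X ^ 2) * derivative q) = (2 * α + 1) * L (X * q))
    (hpos : ∀ p : ℝ[X], p ≠ 0 → (∀ t ∈ Set.Icc (-1 : ℝ) 1, 0 ≤ p.eval t) → 0 < L p)
    (m : ℕ) : (gegenbauer α m).Splits := by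
  obtain ⟨u, hu⟩ := UniqueFactorizationMonoid.factors_prod (gegenbauer_ne_zero hα m)
  rw [← hu]
  refine (Splits.multisetProd fun g hmem => ?_).mul u.isUnit.splits
  have hg := UniqueFactorizationMonoid.irreducible_of_factor g hmem
  have hdvd := UniqueFactorizationMonoid.dvd_of_mem_factors hmem
  have hg0 : 0 < g.natDegree := hg.natDegree_pos
  obtain ⟨s, -, hs⟩ := gegenbauer_factor_exists_neg hα hL hpos hdvd hg0
  obtain ⟨t, -, ht⟩ := gegenbauer_factor_exists_neg hα hL hpos ((neg_dvd).2 hdvd)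
    (by rwa [natDegree_neg])
  rw [eval_neg] at ht
  obtain ⟨r, hr⟩ := mem_range_of_exists_le_of_exists_ge g.continuous ⟨s, hs.le⟩
    ⟨t, by linarith⟩
  exact Splits.of_degree_eq_one (degree_eq_one_of_irreducible_of_root hg hr)

end Functional

/-! ### Distance of the largest root to 1 -/

theorem eval_derivative_prod_X_sub_C (s : Multiset ℝ) (hs : ∀ r ∈ s, r < 1) :
    let p := (s.map fun r => X - C r).prod
    0 < p.eval 1 ∧
    (derivative p).eval 1 = p.eval 1 * (s.map fun r => (1 - r)⁻¹).sum ∧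
    (derivative (derivative p)).eval 1 =
      p.eval 1 * ((s.map fun r => (1 - r)⁻¹).sum ^ 2 - (s.map fun r => ((1 - r)⁻¹) ^ 2).sum) := by
  induction s using Multiset.induction with
  | empty => simp
  | cons a s ih =>
    obtain ⟨h₀, h₁, h₂⟩ := ih fun r hr => hs r (Multiset.mem_cons_of_mem hr)
    have ha : 0 < 1 - a := sub_pos.2 (hs a (Multiset.mem_cons_self a s))
    refine ⟨?_, ?_, ?_⟩
    · simpa using mul_pos ha h₀
    · simp [derivative_mul, h₁]
      field_simp
    · simp [derivative_mul, h₁, h₂]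
      field_simp
      ring

/-- Two-sided bounds for the distance to `1` of the largest root of a split polynomial,
in terms of its first two derivatives at `1`. -/
theorem Polynomial.Splits.largest_root_bounds {p : ℝ[X]} (hp : p.Splits) (hp1 : 0 < p.eval 1)
    (hlt : ∀ r, p.IsRoot r → r < 1) {r : ℝ} (hr : IsGreatest {t | p.IsRoot t} r) :
    p.eval 1 ≤ (1 - r) * (derivative p).eval 1 ∧
      (1 - r) * ((derivative p).eval 1 ^ 2 - p.eval 1 * (derivative (derivative p)).eval 1) ≤
        p.eval 1 * (derivative p).eval 1 := by
  have hp0 : p ≠ 0 := by rintro rfl; simp at hp1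
  have hroot : ∀ t, t ∈ p.roots ↔ p.IsRoot t := fun t => mem_roots hp0
  obtain ⟨h₀, h₁, h₂⟩ := eval_derivative_prod_X_sub_C p.roots fun t ht => hlt t ((hroot t).1 ht)
  set q := (p.roots.map fun r => X - C r).prod
  set S₁ := (p.roots.map fun r => (1 - r)⁻¹).sum with hS₁
  set S₂ := (p.roots.map fun r => ((1 - r)⁻¹) ^ 2).sum with hS₂
  have hpq : p = C p.leadingCoeff * q := hp.eq_prod_roots
  set a := p.leadingCoeff
  have e₀ : p.eval 1 = a * q.eval 1 := by rw [hpq]; simp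
  have e₁ : (derivative p).eval 1 = p.eval 1 * S₁ := by
    rw [e₀, hpq]; simp [h₁]; ring
  have e₂ : (derivative (derivative p)).eval 1 = p.eval 1 * (S₁ ^ 2 - S₂) := by
    rw [e₀, hpq]; simp [h₂]; ring
  have hr1 : 0 < 1 - r := sub_pos.2 (hlt r hr.1)
  have hS₁r : (1 - r)⁻¹ ≤ S₁ := by
    refine Multiset.single_le_sum (fun x hx => ?_) _
      (Multiset.mem_map_of_mem (fun r => (1 - r)⁻¹) ((hroot r).2 hr.1))
    obtain ⟨t, ht, rfl⟩ := Multiset.mem_map.1 hx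
    exact inv_nonneg.2 (sub_pos.2 (hlt t ((hroot t).1 ht))).le
  -- The largest root has the largest reciprocal `1/(1 - r)`, so one factor of each square is
  -- bounded by it.
  have hS₂r : S₂ ≤ (1 - r)⁻¹ * S₁ := by
    rw [hS₁, hS₂, ← Multiset.sum_map_mul_left]
    refine Multiset.sum_map_le_sum_map _ _ fun t ht => ?_
    have ht1 : 0 < 1 - t := sub_pos.2 (hlt t ((hroot t).1 ht))
    have : (1 - t)⁻¹ ≤ (1 - r)⁻¹ := inv_anti₀ hr1 (by linarith [hr.2 ((hroot t).1 ht)])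
    rw [sq]
    gcongr
  have k₁ : 1 ≤ (1 - r) * S₁ := by
    rwa [inv_le_iff_one_le_mul₀ hr1, mul_comm] at hS₁r
  have k₂ : (1 - r) * S₂ ≤ S₁ := by
    calc (1 - r) * S₂ ≤ (1 - r) * ((1 - r)⁻¹ * S₁) := by gcongr
      _ = S₁ := by field_simp
  rw [e₁, e₂]
  constructor
  · nlinarith
  · nlinarith [mul_le_mul_of_nonneg_left k₂ (sq_nonneg (p.eval 1))]

theorem one_sub_largest_root_bounds {α : ℝ} (hα : 0 < α) {m : ℕ}
    (hsplit : (gegenbauer α m).Splits)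
    (hlt : ∀ r, (gegenbauer α m).IsRoot r → r < 1) {r : ℝ}
    (hr : IsGreatest {t | (gegenbauer α m).IsRoot t} r) :
    2 * α + 1 ≤ (1 - r) * (m * (m + 2 * α)) ∧
      2 * (1 - r) * (m * (m + 2 * α)) ≤ (2 * α + 1) * (2 * α + 3) := by
  have hP := gegenbauer_eval_one_pos hα m
  obtain ⟨h₁, h₂⟩ := hsplit.largest_root_bounds hP hlt hr
  have e₁ := gegenbauer_derivative_eval_one α m
  have e₂ := gegenbauer_derivative_derivative_eval_one α m
  set P := (gegenbauer α m).eval 1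
  set D := (derivative (gegenbauer α m)).eval 1
  set E := (derivative (derivative (gegenbauer α m))).eval 1
  set N : ℝ := m * (m + 2 * α)
  have hr1 : 0 < 1 - r := sub_pos.2 (hlt r hr.1)
  have hD : 0 < D := pos_of_mul_pos_right (hP.trans_le h₁) hr1.le
  constructor
  · refine le_of_mul_le_mul_right ?_ hP
    linear_combination (2 * α + 1) * h₁ + (1 - r) * e₁
  -- This is the exact form of the second root bound after eliminating `D` and `E`; the square is
  -- then dropped.
  · have h : (1 - r) * (2 * N + (2 * α + 1) ^ 2) ≤ (2 * α + 1) * (2 * α + 3) := by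
      refine le_of_mul_le_mul_right ?_ (mul_pos hP hD)
      linear_combination (2 * α + 1) * (2 * α + 3) * h₂ + (1 - r) * (2 * α + 1) * P * e₂
        - (1 - r) * (2 * α + 3) * D * e₁
    nlinarith [sq_nonneg (2 * α + 1)]

/-! ### Moments of the sphere from Gaussian integrals -/

section PolarCoordinates

variable {E : Type*} [NormedAddCommGroup E] [InnerProductSpace ℝ E] [FiniteDimensional ℝ E]
  [MeasurableSpace E] [BorelSpace E] [Nontrivial E]

open Set Module

/-- `⟨x, y⟩^k` is homogeneous of degree `k`, so the integral factors in polar coordinates. -/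
theorem integral_inner_pow_mul_fun_norm (x : E) (k : ℕ) (f : ℝ → ℝ) :
    ∫ y : E, inner ℝ x y ^ k * f ‖y‖ =
      (∫ y : Metric.sphere (0 : E) 1, inner ℝ x (y : E) ^ k ∂(volume : Measure E).toSphere) *
        ∫ r in Ioi (0 : ℝ), r ^ (finrank ℝ E - 1) * (r ^ k * f r) := by
  calc
    ∫ y : E, inner ℝ x y ^ k * f ‖y‖ =
        ∫ y : ({(0)}ᶜ : Set E), inner ℝ x y.1 ^ k * f ‖y.1‖ ∂((volume : Measure E).comap (Subtype.val : ({(0)}ᶜ : Set E) → E)) := by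
      rw [integral_subtype_comap (measurableSet_singleton _).compl
        fun y : E ↦ inner ℝ x y ^ k * f (‖y‖), restrict_compl_singleton]
    _ = ∫ z : Metric.sphere (0 : E) 1 × Ioi (0 : ℝ), inner ℝ x z.1.1 ^ k * (z.2.1 ^ k * f z.2.1)
          ∂((volume : Measure E).toSphere.prod (.volumeIoiPow (finrank ℝ E - 1))) := by
      rw [← (volume : Measure E).measurePreserving_homeomorphUnitSphereProd.integral_comp
        (Homeomorph.measurableEmbedding _)]
      refine integral_congr_ae (.of_forall fun y => ?_)
      have hy : ‖y.1‖ ≠ 0 := norm_ne_zero_iff.2 y.2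
      simp only [homeomorphUnitSphereProd_apply_fst_coe, homeomorphUnitSphereProd_apply_snd_coe,
        inner_smul_right]
      rw [← mul_assoc, ← mul_pow]
      congr 2
      field_simp
    _ = _ := by
      rw [integral_prod_mul (fun y : Metric.sphere (0 : E) 1 => inner ℝ x (y : E) ^ k)
        (fun r : Ioi (0 : ℝ) => r.1 ^ k * f r.1)]
      congr 1
      simp only [Measure.volumeIoiPow, ENNReal.ofReal]
      rw [integral_withDensity_eq_integral_smul,
        integral_subtype_comap measurableSet_Ioi
          fun a ↦ Real.toNNReal (a ^ (finrank ℝ E - 1)) • (a ^ k * f a),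
        setIntegral_congr_fun measurableSet_Ioi fun x hx ↦ ?_]
      · rw [NNReal.smul_def, Real.coe_toNNReal _ (pow_nonneg hx.out.le _), smul_eq_mul]
      · exact (measurable_subtype_coe.pow_const _).real_toNNReal

theorem integrable_norm_pow_mul_exp_neg_norm_sq (k : ℕ) :
    Integrable fun y : E => ‖y‖ ^ k * Real.exp (-‖y‖ ^ 2) := by
  rw [integrable_fun_norm_addHaar volume (f := fun r => r ^ k * Real.exp (-r ^ 2))]
  have h := integrableOn_rpow_mul_exp_neg_mul_sq one_pos (s := ((finrank ℝ E - 1 + k : ℕ) : ℝ))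
    (by linarith [(finrank ℝ E - 1 + k : ℕ).cast_nonneg (α := ℝ)])
  refine h.congr_fun (fun r _ => ?_) measurableSet_Ioi
  simp only [Real.rpow_natCast, pow_add, smul_eq_mul, neg_mul, one_mul]
  ring

theorem integrable_inner_pow_mul_exp_neg_norm_sq (x : E) (k : ℕ) :
    Integrable fun y : E => inner ℝ x y ^ k * Real.exp (-‖y‖ ^ 2) := by
  refine ((integrable_norm_pow_mul_exp_neg_norm_sq (E := E) k).const_mul (‖x‖ ^ k)).mono'
    (by fun_prop) (.of_forall fun y => ?_)
  rw [norm_mul, norm_pow, Real.norm_of_nonneg (Real.exp_pos _).le, ← mul_assoc, ← mul_pow]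
  gcongr
  exact norm_inner_le_norm x y

/-- Integration by parts in the direction `x`, moving the derivative between `⟨x, y⟩^(k+1)` and the
Gaussian. -/
theorem integral_inner_pow_add_two_mul_exp_neg_norm_sq {x : E} (hx : ‖x‖ = 1) (k : ℕ) :
    2 * ∫ y : E, inner ℝ x y ^ (k + 2) * Real.exp (-‖y‖ ^ 2) =
      (k + 1) * ∫ y : E, inner ℝ x y ^ k * Real.exp (-‖y‖ ^ 2) := by
  have hf (y : E) : HasFDerivAt (fun y : E => inner ℝ x y ^ (k + 1))
      (((k + 1 : ℕ) * inner ℝ x y ^ k) • innerSL ℝ x) y := by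
    simpa using ((innerSL ℝ x).hasFDerivAt (x := y)).pow (k + 1)
  have hg (y : E) : HasFDerivAt (fun y : E => Real.exp (-‖y‖ ^ 2))
      (Real.exp (-‖y‖ ^ 2) • -((2 : ℕ) • innerSL ℝ y : E →L[ℝ] ℝ)) y :=
    ((hasStrictFDerivAt_norm_sq y).hasFDerivAt.neg).exp
  have ef (y : E) : fderiv ℝ (fun y : E => inner ℝ x y ^ (k + 1)) y x =
      (k + 1) * inner ℝ x y ^ k := by
    rw [(hf y).fderiv]; simp [hx]
  have eg (y : E) : fderiv ℝ (fun y : E => Real.exp (-‖y‖ ^ 2)) y x =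
      -(2 * (inner ℝ x y * Real.exp (-‖y‖ ^ 2))) := by
    rw [(hg y).fderiv]
    simp [real_inner_comm x y]
    ring
  have h := integral_mul_fderiv_eq_neg_fderiv_mul_of_integrable (μ := (volume : Measure E))
    (f := fun y : E => inner ℝ x y ^ (k + 1)) (g := fun y => Real.exp (-‖y‖ ^ 2)) (v := x)
    (by
      simp only [ef, mul_assoc]
      exact (integrable_inner_pow_mul_exp_neg_norm_sq x k).const_mul _)
    (by
      simp only [eg]
      convert ((integrable_inner_pow_mul_exp_neg_norm_sq x (k + 2)).const_mul (-2)) using 2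
      ring)
    (integrable_inner_pow_mul_exp_neg_norm_sq x (k + 1))
    (fun y _ => (hf y).differentiableAt) (fun y _ => (hg y).differentiableAt)
  simp only [ef, eg] at h
  rw [← integral_const_mul, ← integral_const_mul]
  calc ∫ y : E, 2 * (inner ℝ x y ^ (k + 2) * Real.exp (-‖y‖ ^ 2))
      = -∫ y : E, inner ℝ x y ^ (k + 1) * -(2 * (inner ℝ x y * Real.exp (-‖y‖ ^ 2))) := by
        rw [← integral_neg]
        exact integral_congr_ae (.of_forall fun y => by ring)
    _ = ∫ y : E, (k + 1) * (inner ℝ x y ^ k * Real.exp (-‖y‖ ^ 2)) := by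
        rw [h, neg_neg]
        exact integral_congr_ae (.of_forall fun y => by ring)

theorem integral_Ioi_pow_mul_exp_neg_sq (k : ℕ) :
    ∫ r in Ioi (0 : ℝ), r ^ k * Real.exp (-r ^ 2) = 1 / 2 * Real.Gamma ((k + 1) / 2) := by
  rw [← integral_rpow_mul_exp_neg_rpow two_pos (by linarith [k.cast_nonneg (α := ℝ)])]
  simp

theorem integral_sphere_inner (x : E) :
    ∫ y : Metric.sphere (0 : E) 1, inner ℝ x (y : E) ∂(volume : Measure E).toSphere = 0 := by
  have h := integral_inner_pow_mul_fun_norm x 1 (fun r => Real.exp (-r ^ 2))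
  have h0 : ∫ y : E, inner ℝ x y ^ 1 * Real.exp (-‖y‖ ^ 2) = 0 := by
    have := integral_neg_eq_self (fun y : E => inner ℝ x y ^ 1 * Real.exp (-‖y‖ ^ 2)) volume
    simp only [inner_neg_right, norm_neg, pow_one, neg_mul, integral_neg] at this ⊢
    linarith
  have e : ∫ r in Ioi (0 : ℝ), r ^ (finrank ℝ E - 1) * (r ^ 1 * Real.exp (-r ^ 2)) =
      1 / 2 * Real.Gamma (((finrank ℝ E - 1 + 1 : ℕ) + 1) / 2) := by
    rw [← integral_Ioi_pow_mul_exp_neg_sq]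
    simp only [pow_add, mul_assoc]
  have hG := Real.Gamma_pos_of_pos
    (show (0 : ℝ) < ((finrank ℝ E - 1 + 1 : ℕ) + 1) / 2 by positivity)
  rw [h0, e] at h
  simp only [pow_one] at h
  exact (mul_eq_zero.1 h.symm).resolve_right (by positivity)

/-- The moments of the zonal functions on the unit sphere. -/
theorem integral_sphere_inner_pow_add_two {x : E} (hx : ‖x‖ = 1) (k : ℕ) :
    ((k : ℝ) + finrank ℝ E) *
        ∫ y : Metric.sphere (0 : E) 1, inner ℝ x (y : E) ^ (k + 2) ∂(volume : Measure E).toSphere =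
      (k + 1) *
        ∫ y : Metric.sphere (0 : E) 1, inner ℝ x (y : E) ^ k ∂(volume : Measure E).toSphere := by
  have hE : 0 < finrank ℝ E := finrank_pos
  have h := integral_inner_pow_add_two_mul_exp_neg_norm_sq hx k
  obtain ⟨d, hd⟩ : ∃ d, finrank ℝ E = d + 1 := ⟨_, (Nat.succ_pred_eq_of_pos hE).symm⟩
  have e (j : ℕ) : ∫ r in Ioi (0 : ℝ), r ^ d * (r ^ j * Real.exp (-r ^ 2)) =
      1 / 2 * Real.Gamma (((d + j : ℕ) + 1) / 2) := by
    rw [← integral_Ioi_pow_mul_exp_neg_sq]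
    simp only [pow_add, mul_assoc]
  rw [integral_inner_pow_mul_fun_norm x k (fun r => Real.exp (-r ^ 2)),
    integral_inner_pow_mul_fun_norm x (k + 2) (fun r => Real.exp (-r ^ 2)), hd,
    Nat.add_sub_cancel, e, e] at h
  -- The radial factors for `k + 2` and `k` differ by `(d + k + 1)/2`, the source of `k + finrank ℝ
  -- E`.
  have hG : Real.Gamma (((d + (k + 2) : ℕ) + 1) / 2) =
      (((d + k : ℕ) + 1) / 2) * Real.Gamma (((d + k : ℕ) + 1) / 2) := by
    rw [← Real.Gamma_add_one (by positivity)]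
    congr 1
    push_cast
    ring
  have hG0 : 0 < Real.Gamma (((d + k : ℕ) + 1) / 2) := Real.Gamma_pos_of_pos (by positivity)
  rw [hG] at h
  rw [hd]
  apply mul_right_cancel₀ hG0.ne'
  push_cast at h ⊢
  linear_combination 2 * h

end PolarCoordinates

/-! ### The zonal functional: integration by parts, invariance, positivity -/

section Zonal

variable {n : ℕ}

theorem UnitSphere.continuous_inner (x : UnitSphere n) :
    Continuous fun y : UnitSphere n =>
      inner ℝ (x : EuclideanSpace ℝ (Fin n)) (y : EuclideanSpace ℝ (Fin n)) := by
  fun_prop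

theorem UnitSphere.inner_mem_Icc (x y : UnitSphere n) :
    inner ℝ (x : EuclideanSpace ℝ (Fin n)) (y : EuclideanSpace ℝ (Fin n)) ∈
      Set.Icc (-1 : ℝ) 1 := by
  have h := abs_real_inner_le_norm (x : EuclideanSpace ℝ (Fin n)) y
  rw [norm_eq_of_mem_sphere, norm_eq_of_mem_sphere, one_mul] at h
  exact abs_le.1 h

theorem Continuous.integrable_sphereMeasure {f : UnitSphere n → ℝ} (hf : Continuous f) :
    Integrable f (sphereMeasure n) :=
  hf.integrable_of_hasCompactSupport (HasCompactSupport.of_compactSpace f)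

/-- The functional `p ↦ ∫ p(⟨x, y⟩) dμ(y)` on polynomials. -/
noncomputable def zonalFunctional (x : UnitSphere n) : ℝ[X] →ₗ[ℝ] ℝ where
  toFun p := ∫ y : UnitSphere n,
    p.eval (inner ℝ (x : EuclideanSpace ℝ (Fin n)) (y : EuclideanSpace ℝ (Fin n)))
      ∂(sphereMeasure n)
  map_add' p q := by
    simp only [eval_add]
    exact integral_add (p.continuous.comp x.continuous_inner).integrable_sphereMeasure
      (q.continuous.comp x.continuous_inner).integrable_sphereMeasure
  map_smul' a p := by
    simp [integral_const_mul]

theorem zonalFunctional_apply (x : UnitSphere n) (p : ℝ[X]) :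
    zonalFunctional x p = ∫ y : UnitSphere n,
      p.eval (inner ℝ (x : EuclideanSpace ℝ (Fin n)) (y : EuclideanSpace ℝ (Fin n)))
        ∂(sphereMeasure n) := rfl

theorem zonalFunctional_X (hn : 0 < n) (x : UnitSphere n) : zonalFunctional x X = 0 := by
  have : Nonempty (Fin n) := ⟨⟨0, hn⟩⟩
  rw [zonalFunctional_apply]
  simpa using integral_sphere_inner (x : EuclideanSpace ℝ (Fin n))

theorem zonalFunctional_X_pow_add_two (hn : 0 < n) (x : UnitSphere n) (k : ℕ) :
    ((k : ℝ) + n) * zonalFunctional x (X ^ (k + 2)) = (k + 1) * zonalFunctional x (X ^ k) := by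
  have : Nonempty (Fin n) := ⟨⟨0, hn⟩⟩
  simp only [zonalFunctional_apply, eval_pow, eval_X]
  simpa using integral_sphere_inner_pow_add_two
    (norm_eq_of_mem_sphere x : ‖(x : EuclideanSpace ℝ (Fin n))‖ = 1) k

theorem zonalFunctional_integration_by_parts (hn : 0 < n) (x : UnitSphere n) (q : ℝ[X]) :
    zonalFunctional x ((1 - X ^ 2) * derivative q) = ((n : ℝ) - 1) * zonalFunctional x (X * q) := by
  induction q using Polynomial.induction_on' with
  | add p q hp hq => rw [derivative_add, mul_add, mul_add, map_add, map_add, hp, hq, mul_add]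
  | monomial k a =>
    rw [← C_mul_X_pow_eq_monomial, derivative_C_mul, mul_left_comm, mul_left_comm X,
      functional_C_mul, functional_C_mul]
    cases k with
    | zero => simp [zonalFunctional_X hn]
    | succ k =>
      have h := zonalFunctional_X_pow_add_two hn x k
      have e : (1 - X ^ 2) * derivative (X ^ (k + 1) : ℝ[X]) =
          C ((k : ℝ) + 1) * (X ^ k - X ^ (k + 2)) := by
        simp only [derivative_X_pow, Nat.cast_add, Nat.cast_one, Nat.add_sub_cancel]
        ring
      rw [e, functional_C_mul, map_sub, show X * X ^ (k + 1) = (X ^ (k + 2) : ℝ[X]) by ring]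
      linear_combination (-a) * h

/-- The moment recursion and its initial values do not involve `x`; hence one constant `c`
normalizes the filter at every point. -/
theorem zonalFunctional_eq (hn : 0 < n) (x x' : UnitSphere n) :
    zonalFunctional x = zonalFunctional x' := by
  have h (k : ℕ) : zonalFunctional x (X ^ k) = zonalFunctional x' (X ^ k) := by
    induction k using Nat.twoStepInduction with
    | zero => simp [zonalFunctional_apply]
    | one => rw [pow_one, zonalFunctional_X hn, zonalFunctional_X hn]
    | more k ih _ =>
      have hk : (k : ℝ) + n ≠ 0 := by positivity
      apply mul_left_cancel₀ hk
      rw [zonalFunctional_X_pow_add_two hn, zonalFunctional_X_pow_add_two hn, ih]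
  ext k
  simpa [← X_pow_eq_monomial] using h k

/-- The sphere is connected for `n > 1`, so `⟨x, y⟩` fills `[-1, 1]`; a `p` vanishing at all these
values would have infinitely many roots. -/
theorem zonalFunctional_pos (hn : 1 < n) (x : UnitSphere n) {p : ℝ[X]} (hp : p ≠ 0)
    (hnn : ∀ t ∈ Set.Icc (-1 : ℝ) 1, 0 ≤ p.eval t) : 0 < zonalFunctional x p := by
  have hc := p.continuous.comp x.continuous_inner
  rw [zonalFunctional_apply]
  refine (integral_pos_iff_support_of_nonneg (fun y => hnn _ (x.inner_mem_Icc y))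
    hc.integrable_sphereMeasure).2 (hc.isOpen_support.measure_pos _ ?_)
  by_contra hempty
  rw [Set.not_nonempty_iff_eq_empty, Function.support_eq_empty_iff] at hempty
  have hconn : PreconnectedSpace (UnitSphere n) := by
    refine Subtype.preconnectedSpace (isPreconnected_sphere ?_ _ _)
    rw [rank_eq_card_basis (EuclideanSpace.basisFun (Fin n) ℝ).toBasis, Fintype.card_fin]
    exact_mod_cast hn
  have hxx : inner ℝ (x : EuclideanSpace ℝ (Fin n)) (x : EuclideanSpace ℝ (Fin n)) = (1 : ℝ) := by
    rw [real_inner_self_eq_norm_sq, norm_eq_of_mem_sphere, one_pow]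
  refine hp (eq_zero_of_infinite_isRoot p ((Set.Icc_infinite (by norm_num : (-1 : ℝ) < 1)).mono ?_))
  intro t ht
  obtain ⟨y, hy⟩ := mem_range_of_exists_le_of_exists_ge x.continuous_inner (c := t)
    ⟨-x, by simpa [hxx] using ht.1⟩ ⟨x, by simpa [hxx] using ht.2⟩
  change p.eval t = 0
  rw [← hy]
  exact congrFun hempty y

end Zonal

/-! ### Approximation by a filter with prescribed first moment -/

/-- This is `cos s ≤ 1 - (2/π²) s²` on `[0, π]` at `s = arccos t`. -/
theorem Real.arccos_le_mul_sqrt_one_sub {t : ℝ} (ht : t ∈ Set.Icc (-1 : ℝ) 1) :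
    Real.arccos t ≤ Real.pi / √2 * √(1 - t) := by
  have h := Real.cos_le_one_sub_mul_cos_sq (x := Real.arccos t)
    (by rw [abs_of_nonneg (Real.arccos_nonneg t)]; exact Real.arccos_le_pi t)
  rw [Real.cos_arccos ht.1 ht.2] at h
  refine (sq_le_sq₀ (Real.arccos_nonneg t) (by positivity)).1 ?_
  rw [mul_pow, div_pow, Real.sq_sqrt two_pos.le, Real.sq_sqrt (by linarith [ht.2])]
  have hpi := Real.pi_pos
  field_simp at h ⊢
  linarith

theorem HasLipschitzConstant.continuous {n : ℕ} {f : UnitSphere n → ℝ} {κ : ℝ}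
    (hf : HasLipschitzConstant f κ) : Continuous f := by
  rw [continuous_iff_continuousAt]
  intro x
  rw [ContinuousAt, tendsto_iff_dist_tendsto_zero]
  have hg : Continuous fun y : UnitSphere n => κ * geodesicDist y x := by
    unfold geodesicDist
    fun_prop
  have h0 : κ * geodesicDist x x = 0 := by
    rw [geodesicDist, real_inner_self_eq_norm_sq, norm_eq_of_mem_sphere, one_pow, Real.arccos_one,
      mul_zero]
  refine squeeze_zero (fun _ => dist_nonneg) (fun y => hf y x) ?_
  simpa only [h0] using hg.tendsto x

theorem HasLipschitzConstant.nonneg {n : ℕ} {f : UnitSphere n → ℝ} {κ : ℝ}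
    (hf : HasLipschitzConstant f κ) (x : UnitSphere n) : 0 ≤ κ := by
  have h := (abs_nonneg _).trans (hf x (-x))
  have e : geodesicDist x (-x) = Real.pi := by
    simp [geodesicDist]
  rw [e] at h
  exact nonneg_of_mul_nonneg_left h Real.pi_pos

/-- Approximation by a nonnegative filter of total mass one whose first moment is `r < 1`. -/
theorem HasLipschitzConstant.abs_sub_sphericalConvolution_le {n : ℕ} {f : UnitSphere n → ℝ} {κ : ℝ}
    (hf : HasLipschitzConstant f κ) {u : ℝ[X]} (hu : ∀ t ∈ Set.Icc (-1 : ℝ) 1, 0 ≤ u.eval t)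
    {r : ℝ} (hr : r < 1) (x : UnitSphere n) (h₀ : zonalFunctional x u = 1)
    (h₁ : zonalFunctional x (u * X) = r) :
    |f x - sphericalConvolution u f x| ≤ (Real.pi / √2 * √(1 - r)) * κ := by
  have hκ := hf.nonneg x
  have hr' : 0 < 1 - r := sub_pos.2 hr
  set a := √(1 - r) with ha
  have ha0 : 0 < a := Real.sqrt_pos.2 hr'
  have ha2 : a ^ 2 = 1 - r := Real.sq_sqrt hr'.le
  have hcu : Continuous fun y : UnitSphere n =>
      u.eval (inner ℝ (x : EuclideanSpace ℝ (Fin n)) (y : EuclideanSpace ℝ (Fin n))) :=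
    u.continuous.comp x.continuous_inner
  have hcf : Continuous fun y : UnitSphere n =>
      u.eval (inner ℝ (x : EuclideanSpace ℝ (Fin n)) (y : EuclideanSpace ℝ (Fin n))) * f y :=
    hcu.mul hf.continuous
  -- The tangent line of the root at `s = a² = 1 - r`, in place of Jensen's inequality.
  have hsqrt (s : ℝ) (hs : 0 ≤ s) : √s ≤ (s / a + a) / 2 := by
    have h := sq_nonneg (√s - a)
    rw [sub_sq, Real.sq_sqrt hs] at h
    rw [le_div_iff₀ two_pos, ← sub_nonneg]
    have : s / a + a - √s * 2 = (s - 2 * √s * a + a ^ 2) / a := by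
      field_simp
      ring
    rw [this]
    positivity
  have hx : f x = ∫ y : UnitSphere n,
      u.eval (inner ℝ (x : EuclideanSpace ℝ (Fin n)) (y : EuclideanSpace ℝ (Fin n))) * f x
        ∂(sphereMeasure n) := by
    rw [integral_mul_const, ← zonalFunctional_apply, h₀, one_mul]
  -- The tangent-line majorant of the integrand; its integral needs only the mass and first moment
  -- of `u`.
  set v : ℝ[X] := C (κ * (Real.pi / √2) / 2) * (C (a⁻¹ + a) * u - C a⁻¹ * (u * X)) with hv
  have hLv : zonalFunctional x v = Real.pi / √2 * a * κ := by
    rw [hv, functional_C_mul, map_sub, functional_C_mul, functional_C_mul, h₀, h₁]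
    have : a⁻¹ * (1 - r) = a := by rw [← ha2]; field_simp
    linear_combination κ * (Real.pi / √2) / 2 * this
  conv_lhs => rw [hx]
  rw [sphericalConvolution, ← integral_sub (hcu.mul_const (f x)).integrable_sphereMeasure
    hcf.integrable_sphereMeasure, ← hLv, zonalFunctional_apply]
  refine abs_integral_le_integral_abs.trans (integral_mono
    ((hcu.mul_const (f x)).sub hcf).abs.integrable_sphereMeasure
    (v.continuous.comp x.continuous_inner).integrable_sphereMeasure fun y => ?_)
  have ht := x.inner_mem_Icc y
  have hfy := hf x y
  rw [geodesicDist] at hfy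
  simp only [hv, eval_mul, eval_sub, eval_C, eval_X]
  set t : ℝ := inner ℝ (x : EuclideanSpace ℝ (Fin n)) (y : EuclideanSpace ℝ (Fin n))
  have hut := hu t ht
  rw [← mul_sub, abs_mul, abs_of_nonneg hut]
  calc u.eval t * |f x - f y| ≤ u.eval t * (κ * (Real.pi / √2 * ((1 - t) / a + a) / 2)) := by
        gcongr
        refine hfy.trans ?_
        gcongr
        rw [mul_div_assoc]
        refine (Real.arccos_le_mul_sqrt_one_sub ht).trans ?_
        gcongr
        exact hsqrt _ (by linarith [ht.2])
    _ = _ := by ring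

theorem gegenbauerLargestRoot_isGreatest {α : ℝ} (hα : 0 < α) {m : ℕ} (hm : m ≠ 0)
    (h : (gegenbauer α m).Splits) :
    IsGreatest {t | (gegenbauer α m).IsRoot t} (gegenbauerLargestRoot α m) := by
  have hne := gegenbauer_ne_zero hα m
  have hfin : {t | (gegenbauer α m).IsRoot t}.Finite := finite_setOfPred_isRoot hne
  have hnon : {t | (gegenbauer α m).IsRoot t}.Nonempty :=
    h.exists_eval_eq_zero (by
      rw [degree_eq_natDegree hne, gegenbauer_natDegree hα]; exact_mod_cast hm)
  exact ⟨hnon.csSup_mem hfin, fun t ht => le_csSup hfin.bddAbove ht⟩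

/-- The normalized square of `C_{k+1} / (t - r)`, for a root `r` of `C_{k+1}`. -/
theorem exists_normalized_filter {n : ℕ} (hn : 1 < n) {α : ℝ} (hα : 0 < α)
    (hnα : (n : ℝ) - 1 = 2 * α + 1) (x₀ : UnitSphere n) (k : ℕ) {r : ℝ}
    (hr : (gegenbauer α (k + 1)).IsRoot r) :
    ∃ (c : ℝ) (u : ℝ[X]), 0 < c ∧ u * (X - C r) ^ 2 = C c * gegenbauer α (k + 1) ^ 2 ∧
      u.natDegree = 2 * k ∧ (∀ t : ℝ, 0 ≤ u.eval t) ∧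
      ∀ x : UnitSphere n, zonalFunctional x u = 1 ∧ zonalFunctional x (u * X) = r := by
  obtain ⟨q, hq⟩ := dvd_iff_isRoot.2 hr
  have hne := gegenbauer_ne_zero hα (k + 1)
  have hq0 : q ≠ 0 := by rintro rfl; simp [hq] at hne
  have hdeg := gegenbauer_natDegree hα (k + 1)
  rw [hq, natDegree_mul (X_sub_C_ne_zero r) hq0, natDegree_X_sub_C] at hdeg
  have hpos : 0 < zonalFunctional x₀ (q ^ 2) :=
    zonalFunctional_pos hn x₀ (pow_ne_zero 2 hq0) fun t _ => by rw [eval_pow]; positivity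
  set c := (zonalFunctional x₀ (q ^ 2))⁻¹
  have hc : 0 < c := inv_pos.2 hpos
  have h₁ (x : UnitSphere n) : zonalFunctional x (C c * q ^ 2) = 1 := by
    rw [functional_C_mul, zonalFunctional_eq (by omega) x x₀, inv_mul_cancel₀ hpos.ne']
  refine ⟨c, C c * q ^ 2, hc, by rw [hq]; ring, ?_, fun t => ?_, fun x => ⟨h₁ x, ?_⟩⟩
  · rw [natDegree_C_mul hc.ne', natDegree_pow]
    omega
  · simp only [eval_mul, eval_C, eval_pow]
    positivity
  -- `c q C_{k+1} = u X - r u` with `deg q = k`, so orthogonality says that the first moment is `r`.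
  · have h := functional_mul_gegenbauer_eq_zero hα (L := zonalFunctional x)
      (fun q => by rw [zonalFunctional_integration_by_parts (by omega), hnα])
      (m := k + 1) (q := C c * q) ((natDegree_C_mul_le _ _).trans_lt (by omega))
    rw [hq, show C c * q * ((X - C r) * q) = C c * q ^ 2 * X - C r * (C c * q ^ 2) by ring,
      map_sub, functional_C_mul, h₁, mul_one] at h
    linarith

/-! ### Asymptotic order and the main theorem -/

theorem isTheta_sqrt_of_mul_sq_bounds {d : ℕ → ℝ} {A B : ℝ} (hA : 0 < A)
    (hlow : ∀ᶠ k : ℕ in atTop, A ≤ d k * (k : ℝ) ^ 2)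
    (hup : ∀ᶠ k : ℕ in atTop, d k * (k : ℝ) ^ 2 ≤ B) :
    (fun k => √(d k)) =Θ[atTop] fun k : ℕ => ((k : ℝ))⁻¹ := by
  have e : ∀ᶠ k : ℕ in atTop, √A * (k : ℝ)⁻¹ ≤ √(d k) ∧ √(d k) ≤ √B * (k : ℝ)⁻¹ := by
    filter_upwards [hlow, hup, eventually_gt_atTop 0] with k h₁ h₂ hk
    have hk' : (0 : ℝ) < k := by exact_mod_cast hk
    have hs : √(d k * (k : ℝ) ^ 2) = √(d k) * k := by
      rw [Real.sqrt_mul' _ (sq_nonneg _), Real.sqrt_sq hk'.le]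
    rw [← div_eq_mul_inv, ← div_eq_mul_inv, div_le_iff₀ hk', le_div_iff₀ hk', ← hs]
    exact ⟨Real.sqrt_le_sqrt h₁, Real.sqrt_le_sqrt h₂⟩
  constructor
  · refine IsBigO.of_bound √B ?_
    filter_upwards [e] with k hk
    rw [Real.norm_of_nonneg (Real.sqrt_nonneg _), Real.norm_of_nonneg (by positivity)]
    exact hk.2
  · refine IsBigO.of_bound (√A)⁻¹ ?_
    filter_upwards [e] with k hk
    rw [Real.norm_of_nonneg (Real.sqrt_nonneg _), Real.norm_of_nonneg (by positivity),
      ← div_eq_inv_mul, le_div_iff₀ (Real.sqrt_pos.2 hA), mul_comm]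
    exact hk.1

theorem theorem3p1 (n : ℕ) (hn : 3 ≤ n) (α : ℝ) (hα : α = ((n : ℝ) - 2) / 2)
    (lam : ℕ → ℝ) (hlam : ∀ j : ℕ, lam j = gegenbauerLargestRoot α j) :
    (∀ k : ℕ,
      -- `lam (k + 1)` really is the largest root, and `1 - lam (k + 1)` is positive
      IsGreatest {t : ℝ | (gegenbauer α (k + 1)).IsRoot t} (lam (k + 1)) ∧
      lam (k + 1) < 1 ∧
      -- the filter `u = c * (C_{k+1} / (t - lam (k + 1))) ^ 2`, normalized to total mass one
      ∃ (c : ℝ) (u : ℝ[X]),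
        0 < c ∧
        u * (X - C (lam (k + 1))) ^ 2 = C c * gegenbauer α (k + 1) ^ 2 ∧
        (∀ x : UnitSphere n, sphericalConvolution u (fun _ => 1) x = 1) ∧
        u.natDegree = 2 * k ∧
        (∀ t ∈ Set.Icc (-1 : ℝ) 1, 0 ≤ u.eval t) ∧
        ∀ (f : UnitSphere n → ℝ) (κ : ℝ), HasLipschitzConstant f κ →
          ∀ x : UnitSphere n, |f x - sphericalConvolution u f x| ≤
            (Real.pi / √2 * √(1 - lam (k + 1))) * κ) ∧
    -- behaviour of the bound along the degrees `d = 2 * k`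
    (∀ κ : ℝ,
      (fun k : ℕ => (Real.pi / √2 * √(1 - lam (k + 1))) * κ) =Θ[atTop]
        (fun k : ℕ => Real.pi * ((n : ℝ) - 2) / √2 * (κ / ((2 * k : ℕ) : ℝ)))) := by
  have hn' : (3 : ℝ) ≤ n := by exact_mod_cast hn
  have hα0 : 0 < α := by rw [hα]; linarith
  have hnα : (n : ℝ) - 1 = 2 * α + 1 := by rw [hα]; ring
  have : Nontrivial (EuclideanSpace ℝ (Fin n)) := by
    have : Nonempty (Fin n) := ⟨⟨0, by omega⟩⟩
    infer_instance
  obtain ⟨x₀⟩ : Nonempty (UnitSphere n) :=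
    (NormedSpace.sphere_nonempty.2 zero_le_one).to_subtype
  have hL (q : ℝ[X]) : zonalFunctional x₀ ((1 - X ^ 2) * derivative q) =
      (2 * α + 1) * zonalFunctional x₀ (X * q) := by
    rw [zonalFunctional_integration_by_parts (by omega), hnα]
  have hpos (p : ℝ[X]) (hp : p ≠ 0) (h : ∀ t ∈ Set.Icc (-1 : ℝ) 1, 0 ≤ p.eval t) :
      0 < zonalFunctional x₀ p := zonalFunctional_pos (by omega) x₀ hp h
  have hsplit (m : ℕ) : (gegenbauer α m).Splits := gegenbauer_splits hα0 hL hpos m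
  have hlt (m : ℕ) (r : ℝ) (hr : (gegenbauer α m).IsRoot r) : r < 1 :=
    gegenbauer_root_lt_one hα0 hL hpos hr
  have hgreat (k : ℕ) : IsGreatest {t : ℝ | (gegenbauer α (k + 1)).IsRoot t} (lam (k + 1)) := by
    rw [hlam]
    exact gegenbauerLargestRoot_isGreatest hα0 k.succ_ne_zero (hsplit _)
  have hlam1 (k : ℕ) : lam (k + 1) < 1 := hlt _ _ (hgreat k).1
  refine ⟨fun k => ⟨hgreat k, hlam1 k, ?_⟩, fun κ => ?_⟩
  · obtain ⟨c, u, hc, hu, hdeg, hnn, hz⟩ :=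
      exists_normalized_filter (by omega) hα0 hnα x₀ k (hgreat k).1
    refine ⟨c, u, hc, hu, fun x => ?_, hdeg, fun t _ => hnn t, fun f κ hf x =>
      hf.abs_sub_sphericalConvolution_le (fun t _ => hnn t) (hlam1 k) x (hz x).1 (hz x).2⟩
    simp only [sphericalConvolution, mul_one]
    exact (hz x).1
  · have hbounds (k : ℕ) := one_sub_largest_root_bounds hα0 (hsplit (k + 1)) (hlt _) (hgreat k)
    have hΘ : (fun k => √(1 - lam (k + 1))) =Θ[atTop] fun k : ℕ => ((k : ℝ))⁻¹ := by
      -- `A` comes from `k + 1 ≤ 2k` and `k + 1 + 2α ≤ 2k(1 + α)` for `k ≥ 1`; `B` from `k² ≤ (k +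
      -- 1)(k + 1 + 2α)`.
      refine isTheta_sqrt_of_mul_sq_bounds (A := (2 * α + 1) / (4 * (1 + α)))
        (B := (2 * α + 1) * (2 * α + 3) / 2) (by positivity) ?_ ?_
      · filter_upwards [eventually_ge_atTop 1] with k hk
        have hk' : (1 : ℝ) ≤ k := by exact_mod_cast hk
        have h := (hbounds k).1
        have hd := sub_pos.2 (hlam1 k)
        push_cast at h
        rw [div_le_iff₀ (by positivity)]
        calc 2 * α + 1 ≤ (1 - lam (k + 1)) * ((k + 1) * (k + 1 + 2 * α)) := h
          _ ≤ (1 - lam (k + 1)) * ((2 * k) * (2 * k * (1 + α))) := by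
            gcongr
            · linarith
            · nlinarith
          _ = _ := by ring
      · refine .of_forall fun k => ?_
        have h := (hbounds k).2
        have hd := sub_pos.2 (hlam1 k)
        push_cast at h
        have : (k : ℝ) ^ 2 ≤ (k + 1) * (k + 1 + 2 * α) := by
          nlinarith [k.cast_nonneg (α := ℝ)]
        nlinarith [mul_le_mul_of_nonneg_left this hd.le]
    have hconst : Real.pi / √2 ≠ 0 := by positivity
    have hconst' : Real.pi * ((n : ℝ) - 2) / √2 / 2 ≠ 0 := by
      have : (0 : ℝ) < n - 2 := by linarith
      positivity
    have hκ : (fun _ : ℕ => κ) =Θ[atTop] fun _ : ℕ => κ := isTheta_refl _ _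
    have h₁ := ((isTheta_const_mul_left hconst).2
      ((isTheta_const_mul_right hconst').2 hΘ)).mul hκ
    refine h₁.trans_eventuallyEq (.of_forall fun k => ?_)
    push_cast
    rw [div_eq_mul_inv κ, mul_inv]
    ring
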